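/- Let $L_n$ denote the Legendre polynomials and, for $f$ integrable on $[-1,1]$, let $$a_n=\left(n+\tfrac12\right)\int_{-1}^{1}f(x)L_n(x)\,dx$$ be its Legendre coefficients. Let $r\ge 0$ be an integer, let $f:[-1,1]\to\mathbb{R}$ be such that $f,f',\dots,f^{(r-1)}$ are absolutely continuous on $[-1,1]$ and the $r$-th derivative $f^{(r)}$ (for $r\ge1$ defined almost everywhere; for $r=0$ it is $f$ itself) agrees almost everywhere with a function of bounded variation on $[-1,1]$. Put $U_r=\int_{-1}^{1}|f^{(r+1)}(x)|\,dx$, where $f^{(r+1)}$ is the distributional derivative of $f^{(r)}$, that is, $$U_r=\sup\left\{-\int_{-1}^{1}f^{(r)}(x)\varphi'(x)\,dx \;:\; \varphi\in C^1_c(-1,1),\ |\varphi|\le 1\right\}<\infty .$$ Then, for every integer $n\ge\max(r+1,2)$, $$|a_n|\le\frac{\mathbf{A}\,(n+\frac12)\,U_r}{\sqrt{n-r+\frac13}\;\prod_{j=1}^{r+1}\left(n-r+2j-\frac32\right)},\qquad \mathbf{A}=0.825031,$$ and the inequality is strict whenever $U_r\neq0$. -/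

import Mathlib

open MeasureTheory Set
open scoped ENNReal

noncomputable section

namespace LegendreBound

/-- The Legendre polynomial `L_n`, by the Rodrigues formula
`L_n = (1 / (2^n n!)) (d/dx)^n (x^2 - 1)^n`. -/
def legendre (n : ℕ) : Polynomial ℝ :=
  Polynomial.C (1 / (2 ^ n * (Nat.factorial n : ℝ))) *
    Polynomial.derivative^[n] ((Polynomial.X ^ 2 - 1) ^ n)

/-- The `n`-th Legendre coefficient `a_n = (n + 1/2) ∫_{-1}^{1} f(x) L_n(x) dx`. -/
def legendreCoeff (f : ℝ → ℝ) (n : ℕ) : ℝ :=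
  ((n : ℝ) + 1 / 2) * ∫ x in (-1 : ℝ)..1, f x * (legendre n).eval x

/-- The `k`-th derivative `f^{(k)}` of `f` on `[-1, 1]`, one-sided at the endpoints.
At a point where `f^{(k-1)}` is not differentiable Mathlib assigns the value `0`. -/
def derivOn (f : ℝ → ℝ) (k : ℕ) : ℝ → ℝ :=
  iteratedDerivWithin k f (Icc (-1) 1)

/-- `g` is (almost everywhere equal to) a function of bounded variation on `[-1, 1]`. The class
is taken up to null sets because the derivative of an absolutely continuous function is only
defined almost everywhere. -/
def IsBV (g : ℝ → ℝ) : Prop :=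
  ∃ h : ℝ → ℝ, BoundedVariationOn h (Icc (-1) 1) ∧
    g =ᵐ[volume.restrict (Icc (-1) 1)] h

/-- The total mass `∫_{-1}^{1} |g'(x)| dx` of the distributional derivative `g'` of `g` on
`(-1, 1)`: the supremum of the pairing of `g'` with the `C^1` functions that are compactly
supported in `(-1, 1)` and bounded by `1` in absolute value. (Replacing `φ` by `-φ` shows that the
sign in `⟨g', φ⟩ = -∫ g φ'` is immaterial for the supremum.) It equals the Lebesgue integral of
`|g'|` if `g` is absolutely continuous, and a jump of `g` inside `(-1, 1)` contributes its
height. -/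
def massOfDeriv (g : ℝ → ℝ) : ℝ≥0∞ :=
  ⨆ (φ : ℝ → ℝ) (_ : ContDiff ℝ 1 φ) (_ : HasCompactSupport φ)
    (_ : tsupport φ ⊆ Ioo (-1) 1) (_ : ∀ x, |φ x| ≤ 1),
    ENNReal.ofReal (-∫ x in (-1 : ℝ)..1, g x * deriv φ x)

/-- `U_r = ∫_{-1}^{1} |f^{(r+1)}(x)| dx`, where `f^{(r+1)}` is the distributional derivative of
`f^{(r)}`. It is finite when `f^{(r)}` is of bounded variation. -/
def U (f : ℝ → ℝ) (r : ℕ) : ℝ :=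
  (massOfDeriv (derivOn f r)).toReal

/-- The right-hand side
`A (n + 1/2) U_r / (sqrt (n - r + 1/3) * ∏_{j=1}^{r+1} (n - r + 2 j - 3/2))`, `A = 0.825031`. -/
def coeffBound (f : ℝ → ℝ) (r n : ℕ) : ℝ :=
  0.825031 * ((n : ℝ) + 1 / 2) * U f r /
    (Real.sqrt ((n : ℝ) - r + 1 / 3) *
      ∏ j ∈ Finset.Icc 1 (r + 1), ((n : ℝ) - r + 2 * (j : ℝ) - 3 / 2))

end LegendreBound

end

namespace LegendreBound

open Polynomial Filter Topology

/-! By Rodrigues, the `(r+1)`-fold primitive `P` of `L_n` vanishing at `±1` is a multiple of the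
derivative of order `k = n - r - 1` of `(X ^ 2 - 1) ^ n`. Integrating by parts `r` times gives `|∫ f
L_n| = |∫ f^{(r)} P'|`, and this is at most `max |P| * U_r` by duality
(`abs_integral_mul_derivative_le`).

It remains to bound `max |P|`. The differential equation of `P` makes a Sonin function `P ^ 2 + (1 -
x ^ 2) P' ^ 2 / Λ` largest at `0` (`sq_eval_rodrigues_le`). By parity only the value (`k` even) or
the slope (`k` odd) survives there. Both are explicit, and Wallis ratio estimates
(`even_central_value_le`, `odd_central_slope_le`) give the constant `√(2/3) ≈ 0.8165`. This lies
below `0.825 < 0.825031`, whence the strict inequality. -/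

/-! ### Differential equation and Sonin function -/

/-- The `k`-th derivative of `(X ^ 2 - 1) ^ n`. -/
noncomputable def rodrigues (n k : ℕ) : ℝ[X] := derivative^[k] ((X ^ 2 - 1) ^ n)

theorem derivative_rodrigues (n k : ℕ) : derivative (rodrigues n k) = rodrigues n (k + 1) :=
  (Function.iterate_succ_apply' _ _ _).symm

/-- With `u = (X ^ 2 - 1) ^ n`, differentiate `(X ^ 2 - 1) u' = 2 n X u` a total of `k + 1` times.
-/
theorem rodrigues_ode (n k : ℕ) :
    (X ^ 2 - 1) * rodrigues n (k + 2) + C (2 * ((k : ℝ) + 1 - n)) * X * rodrigues n (k + 1)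
      + C (((k : ℝ) + 1) * (k - 2 * n)) * rodrigues n k = 0 := by
  induction k with
  | zero =>
    have h1 : (X ^ 2 - 1) * rodrigues n 1 = C (2 * (n : ℝ)) * X * rodrigues n 0 := by
      rw [← derivative_rodrigues]
      rcases n with _ | n
      · simp [rodrigues]
      · simp only [rodrigues, Function.iterate_zero, id, derivative_pow, derivative_sub,
          derivative_one, derivative_X, Nat.add_sub_cancel, C_mul, map_natCast]
        simp only [map_ofNat]
        push_cast
        ring
    have h2 := congrArg derivative h1
    simp only [derivative_mul, derivative_sub, derivative_X_pow, derivative_one, derivative_C,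
      derivative_X, derivative_rodrigues] at h2
    simp only [C_mul, C_sub, C_add, C_1, map_natCast, map_ofNat] at h2 ⊢
    push_cast at h2 ⊢
    linear_combination h2
  | succ k ih =>
    have h2 := congrArg derivative ih
    simp only [derivative_mul, derivative_sub, derivative_add, derivative_X_pow, derivative_one,
      derivative_C, derivative_X, derivative_zero, derivative_rodrigues] at h2
    simp only [C_mul, C_sub, C_add, C_1, map_natCast, map_ofNat] at h2 ⊢
    push_cast at h2 ⊢
    linear_combination h2

theorem eval_rodrigues_eq_zero {n k : ℕ} (hk : k < n) {x : ℝ} (hx : x ^ 2 = 1) :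
    (rodrigues n k).eval x = 0 := by
  obtain ⟨q, hq⟩ := pow_sub_dvd_iterate_derivative_pow (X ^ 2 - 1 : ℝ[X]) n k
  rw [rodrigues, hq, eval_mul, eval_pow]
  simp [hx, (Nat.sub_pos_of_lt hk).ne']

/-- Sonin's function of `rodrigues n k` is maximal at the origin. -/
theorem sq_eval_rodrigues_le {n k : ℕ} (hk : k < n) {x : ℝ} (hx : x ∈ Icc (-1 : ℝ) 1) :
    (rodrigues n k).eval x ^ 2 ≤ (rodrigues n k).eval 0 ^ 2
      + (rodrigues n (k + 1)).eval 0 ^ 2 / (((k : ℝ) + 1) * (2 * n - k)) := by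
  have hkn : (k : ℝ) + 1 ≤ n := by exact_mod_cast hk
  have hΛ : 0 < ((k : ℝ) + 1) * (2 * n - k) := by
    have : (0 : ℝ) ≤ k := k.cast_nonneg
    apply mul_pos <;> linarith
  set Λ := ((k : ℝ) + 1) * (2 * n - k) with hΛdef
  let F : ℝ[X] := rodrigues n k ^ 2 + C (1 / Λ) * ((1 - X ^ 2) * rodrigues n (k + 1) ^ 2)
  have hF : ∀ t, F.eval t = (rodrigues n k).eval t ^ 2
      + (1 - t ^ 2) * (rodrigues n (k + 1)).eval t ^ 2 / Λ := by
    intro t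
    simp only [F, eval_add, eval_mul, eval_C, eval_pow, eval_sub, eval_one, eval_X]
    ring
  -- `Λ` is chosen so that the equation cancels the `P P'` terms, leaving a derivative of sign
  -- opposite to `t`.
  have hF' : ∀ t, deriv (fun s ↦ F.eval s) t =
      -((4 * (n - k) - 2) / Λ * (rodrigues n (k + 1)).eval t ^ 2) * t := by
    intro t
    have ode := congrArg (eval t) (rodrigues_ode n k)
    simp only [eval_add, eval_mul, eval_C, eval_pow, eval_sub, eval_one, eval_X, eval_zero] at ode
    rw [Polynomial.deriv]
    simp only [F, derivative_add, derivative_mul, derivative_C, derivative_pow, derivative_sub,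
      derivative_one, derivative_X, derivative_rodrigues]
    simp only [eval_add, eval_mul, eval_C, eval_pow, eval_sub, eval_one, eval_X, eval_zero]
    push_cast
    field_simp
    rw [hΛdef]
    linear_combination (-2 * eval t (rodrigues n (k + 1))) * ode
  have hc : 0 ≤ (4 * ((n : ℝ) - k) - 2) / Λ := div_nonneg (by linarith) hΛ.le
  have hle : (rodrigues n k).eval x ^ 2 ≤ F.eval x := by
    rw [hF]
    have : 0 ≤ 1 - x ^ 2 := by nlinarith [hx.1, hx.2]
    have := div_nonneg (mul_nonneg this (sq_nonneg ((rodrigues n (k + 1)).eval x))) hΛ.le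
    linarith
  have h0 : F.eval x ≤ F.eval 0 := by
    rcases le_total 0 x with h | h
    · refine antitoneOn_of_deriv_nonpos (convex_Icc 0 1) F.continuous.continuousOn
        F.differentiable.differentiableOn (fun t ht ↦ ?_) ⟨le_rfl, zero_le_one⟩ ⟨h, hx.2⟩ h
      rw [interior_Icc] at ht
      rw [hF']
      exact mul_nonpos_of_nonpos_of_nonneg (neg_nonpos.2 (mul_nonneg hc (sq_nonneg _))) ht.1.le
    · refine monotoneOn_of_deriv_nonneg (convex_Icc (-1) 0) F.continuous.continuousOn
        F.differentiable.differentiableOn (fun t ht ↦ ?_) ⟨hx.1, h⟩ ⟨by norm_num, le_rfl⟩ h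
      rw [interior_Icc] at ht
      rw [hF']
      exact mul_nonneg_of_nonpos_of_nonpos (neg_nonpos.2 (mul_nonneg hc (sq_nonneg _))) ht.2.le
  refine hle.trans (h0.trans_eq ?_)
  rw [hF]
  ring

/-! ### Values at the origin -/

theorem rodrigues_coeff_zero (n k : ℕ) :
    (rodrigues n k).eval 0 = (k.factorial : ℝ) * ((X ^ 2 - 1 : ℝ[X]) ^ n).coeff k := by
  rw [← coeff_zero_eq_eval_zero, rodrigues, coeff_iterate_derivative, zero_add,
    Nat.descFactorial_self, nsmul_eq_mul]

theorem X_sq_sub_one_pow_eq_expand (n : ℕ) :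
    (X ^ 2 - 1 : ℝ[X]) ^ n = expand ℝ 2 ((X - 1) ^ n) := by
  simp

theorem eval_zero_rodrigues_odd (n p : ℕ) : (rodrigues n (2 * p + 1)).eval 0 = 0 := by
  rw [rodrigues_coeff_zero, X_sq_sub_one_pow_eq_expand, coeff_expand two_pos, if_neg (by omega),
    mul_zero]

theorem sq_eval_zero_rodrigues_even (n p : ℕ) :
    (rodrigues n (2 * p)).eval 0 ^ 2 = (((2 * p).factorial : ℝ) * n.choose p) ^ 2 := by
  rw [rodrigues_coeff_zero, X_sq_sub_one_pow_eq_expand, mul_comm 2 p, coeff_expand_mul two_pos,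
    sub_eq_add_neg, ← C_1, ← C_neg, coeff_X_add_C_pow, mul_pow, mul_pow, mul_pow,
    pow_right_comm (-1 : ℝ), neg_one_sq, one_pow, one_mul]

/-! ### Wallis ratios and bounds for the central values -/

/-- The Wallis ratio `(2 p)! / (4 ^ p * p! ^ 2)`. -/
noncomputable def wallis (p : ℕ) : ℝ := p.centralBinom / 4 ^ p

theorem wallis_succ (p : ℕ) : wallis (p + 1) = wallis p * ((2 * p + 1) / (2 * p + 2)) := by
  have h : ((p : ℝ) + 1) * (p + 1).centralBinom = 2 * (2 * p + 1) * p.centralBinom := by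
    exact_mod_cast Nat.succ_mul_centralBinom_succ p
  have hp : (p : ℝ) + 1 ≠ 0 := by positivity
  rw [wallis, wallis, pow_succ]
  field_simp
  linear_combination 2 * h

/-- The left side is nonincreasing in `q`, with equality at `q = 0`; the constant `2/3` originates
here. -/
theorem wallis_sq_mul_le (q : ℕ) : wallis (q + 1) ^ 2 * (2 * q + 8 / 3) ≤ 2 / 3 := by
  induction q with
  | zero =>
    rw [wallis_succ]
    norm_num [wallis]
  | succ q ih =>
    refine le_trans ?_ ih
    rw [wallis_succ (q + 1), mul_pow, mul_assoc]
    refine mul_le_mul_of_nonneg_left ?_ (sq_nonneg _)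
    push_cast
    have hq : (0 : ℝ) ≤ q := q.cast_nonneg
    rw [div_pow, div_mul_eq_mul_div, div_le_iff₀ (by positivity)]
    nlinarith

theorem wallis_eq (p : ℕ) : wallis p = (2 * p).factorial / (p.factorial ^ 2 * 4 ^ p) := by
  have h : (p.centralBinom : ℝ) * p.factorial * p.factorial = (2 * p).factorial := by
    have := Nat.choose_mul_factorial_mul_factorial (show p ≤ 2 * p by omega)
    rw [show 2 * p - p = p by omega] at this
    exact_mod_cast this
  rw [wallis, ← h]
  have : (p.factorial : ℝ) ≠ 0 := by positivity
  field_simp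

theorem factorial_mul_choose_div_eq (p m : ℕ) :
    ((2 * p).factorial : ℝ) * (2 * p + m).choose p / (2 ^ (2 * p + m) * (2 * p + m).factorial)
      = wallis p / ∏ j ∈ Finset.Icc 1 m, (2 * (p : ℝ) + 2 * j) := by
  have hprod : ((p + m).factorial : ℝ) * 2 ^ m =
      p.factorial * ∏ j ∈ Finset.Icc 1 m, (2 * (p : ℝ) + 2 * j) := by
    induction m with
    | zero => simp
    | succ m ih =>
      rw [Finset.prod_Icc_succ_top (by omega), ← mul_assoc, ← ih, ← add_assoc, Nat.factorial_succ]
      push_cast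
      ring
  have h : ((2 * p + m).choose p : ℝ) * p.factorial * (p + m).factorial
      = (2 * p + m).factorial := by
    have := Nat.choose_mul_factorial_mul_factorial (show p ≤ 2 * p + m by omega)
    rw [show 2 * p + m - p = p + m by omega] at this
    exact_mod_cast this
  have hP : 0 < ∏ j ∈ Finset.Icc 1 m, (2 * (p : ℝ) + 2 * j) :=
    Finset.prod_pos fun j hj ↦ by have := (Finset.mem_Icc.1 hj).1; positivity
  rw [wallis_eq, ← h]
  have h1 : (p.factorial : ℝ) ≠ 0 := by positivity
  have h2 : ((p + m).factorial : ℝ) ≠ 0 := by positivity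
  have h3 : ((2 * p + m).choose p : ℝ) ≠ 0 := by
    exact_mod_cast (Nat.choose_pos (by omega)).ne'
  rw [pow_add, pow_mul]
  norm_num
  generalize ∏ j ∈ Finset.Icc 1 m, (2 * (p : ℝ) + 2 * j) = D at hP hprod ⊢
  field_simp
  linear_combination -hprod

theorem even_central_value_le {p m : ℕ} (hm : 1 ≤ m) (h : 2 ≤ 2 * p + m) :
    (((2 * p).factorial : ℝ) * (2 * p + m).choose p / (2 ^ (2 * p + m) * (2 * p + m).factorial)
      * ∏ j ∈ Finset.Icc 1 m, (2 * (p : ℝ) + 2 * j - 1 / 2)) ^ 2 * (2 * p + 4 / 3) ≤ 2 / 3 := by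
  rw [factorial_mul_choose_div_eq, div_mul_eq_mul_div, mul_div_assoc, ← Finset.prod_div_distrib]
  have hp : (0 : ℝ) ≤ p := p.cast_nonneg
  set c : ℕ → ℝ := fun j ↦ (2 * (p : ℝ) + 2 * j - 1 / 2) / (2 * p + 2 * j)
  have hc0 : ∀ j, 1 ≤ j → 0 ≤ c j := fun j hj ↦ by
    have : (1 : ℝ) ≤ j := by exact_mod_cast hj
    exact div_nonneg (by linarith) (by linarith)
  have hc1 : ∀ j, 1 ≤ j → c j ≤ 1 := fun j hj ↦ by
    have : (1 : ℝ) ≤ j := by exact_mod_cast hj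
    exact (div_le_one (by linarith)).2 (by linarith)
  have hnn : ∀ s, 0 ≤ ∏ j ∈ Finset.Icc 1 s, c j := fun s ↦
    Finset.prod_nonneg fun j hj ↦ hc0 j (Finset.mem_Icc.1 hj).1
  have hanti : ∀ s t, s ≤ t → ∏ j ∈ Finset.Icc 1 t, c j ≤ ∏ j ∈ Finset.Icc 1 s, c j := by
    intro s t hst
    induction t, hst using Nat.le_induction with
    | base => exact le_rfl
    | succ t _ ih =>
      rw [Finset.prod_Icc_succ_top (by omega)]
      exact (mul_le_of_le_one_right (hnn t) (hc1 _ (by omega))).trans ih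
  rcases p with _ | q
  -- For `p = 0` two factors are needed: `(21/32) ^ 2 * 4/3 < 2/3`, whereas one factor gives `(3/4)
  -- ^ 2 * 4/3 = 3/4`. Hence the requirement `n ≥ 2`.
  · have h2 := hanti 2 m (by omega)
    have : ∏ j ∈ Finset.Icc 1 2, c j = 21 / 32 := by
      rw [Finset.prod_Icc_succ_top (by omega), Finset.Icc_self, Finset.prod_singleton]
      norm_num [c]
    rw [this] at h2
    have h0 := hnn m
    have hw : wallis 0 = 1 := by norm_num [wallis]
    rw [hw, one_mul]
    push_cast
    nlinarith
  · have h1 := hanti 1 m hm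
    rw [Finset.Icc_self, Finset.prod_singleton] at h1
    have hsq : (∏ j ∈ Finset.Icc 1 m, c j) ^ 2 * (2 * ((q + 1 : ℕ) : ℝ) + 4 / 3)
        ≤ 2 * q + 8 / 3 := by
      refine (mul_le_mul_of_nonneg_right (pow_le_pow_left₀ (hnn m) h1 2) (by positivity)).trans ?_
      simp only [c]
      push_cast
      have hq : (0 : ℝ) ≤ q := q.cast_nonneg
      rw [div_pow, div_mul_eq_mul_div, div_le_iff₀ (by positivity)]
      nlinarith
    rw [mul_pow, mul_assoc]
    exact (mul_le_mul_of_nonneg_left hsq (sq_nonneg _)).trans (wallis_sq_mul_le q)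

/-- Here `k = 2 q - 1` and the primitive has order `m + 1`, so `n = 2 q + m` and the denominator is
`Λ = (k + 1) (2 n - k)`. -/
theorem odd_central_slope_le {q : ℕ} (hq : 1 ≤ q) (m : ℕ) :
    (((2 * q).factorial : ℝ) * (2 * q + m).choose q / (2 ^ (2 * q + m) * (2 * q + m).factorial)
      * ∏ j ∈ Finset.Icc 1 (m + 1), (2 * (q : ℝ) + 2 * j - 3 / 2)) ^ 2
      / (2 * q * (2 * q + 1 + 2 * m)) * (2 * q + 1 / 3) ≤ 2 / 3 := by
  rw [factorial_mul_choose_div_eq]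
  have hq1 : (1 : ℝ) ≤ q := by exact_mod_cast hq
  -- Relative to the squared product on the right, the left side is nonincreasing in `m`, so the
  -- worst case is `m = 0`.
  have hratio : (∏ j ∈ Finset.Icc 1 (m + 1), (2 * (q : ℝ) + 2 * j - 3 / 2)) ^ 2
      / (2 * q + 1 + 2 * m) ≤ (2 * q + 1 / 2) ^ 2 / (2 * q + 1)
        * (∏ j ∈ Finset.Icc 1 m, (2 * (q : ℝ) + 2 * j)) ^ 2 := by
    induction m with
    | zero =>
      norm_num
      exact le_of_eq (by ring)
    | succ m ih =>
      have e1 := Finset.prod_Icc_succ_top (show 1 ≤ m + 1 + 1 by omega)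
        (fun j : ℕ ↦ 2 * (q : ℝ) + 2 * j - 3 / 2)
      have e2 := Finset.prod_Icc_succ_top (show 1 ≤ m + 1 by omega)
        (fun j : ℕ ↦ 2 * (q : ℝ) + 2 * j)
      rw [e1, e2]
      rw [div_le_iff₀ (by positivity)] at ih ⊢
      rw [mul_pow, mul_pow]
      refine (mul_le_mul_of_nonneg_right ih (sq_nonneg _)).trans ?_
      rw [← mul_assoc, mul_assoc (_ * _), mul_assoc (_ * _)]
      refine mul_le_mul_of_nonneg_left ?_ (by positivity)
      push_cast
      have hm : (0 : ℝ) ≤ m := m.cast_nonneg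
      nlinarith
  have hP : 0 < ∏ j ∈ Finset.Icc 1 m, (2 * (q : ℝ) + 2 * j) :=
    Finset.prod_pos fun j hj ↦ by have := (Finset.mem_Icc.1 hj).1; positivity
  generalize ∏ j ∈ Finset.Icc 1 m, (2 * (q : ℝ) + 2 * j) = D at hP hratio ⊢
  generalize ∏ j ∈ Finset.Icc 1 (m + 1), (2 * (q : ℝ) + 2 * j - 3 / 2) = N at hratio ⊢
  obtain ⟨p, rfl⟩ := Nat.exists_eq_add_of_le' hq
  refine le_trans ?_ (wallis_sq_mul_le p)
  generalize wallis (p + 1) = w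
  have key : (2 * ((p + 1 : ℕ) : ℝ) + 1 / 2) ^ 2 / (2 * (p + 1 : ℕ) + 1)
      * (2 * (p + 1 : ℕ) + 1 / 3) / (2 * (p + 1 : ℕ)) ≤ 2 * p + 8 / 3 := by
    push_cast
    have hp : (0 : ℝ) ≤ p := p.cast_nonneg
    rw [div_mul_eq_mul_div, div_div, div_le_iff₀ (by positivity)]
    nlinarith
  calc (w / D * N) ^ 2 / (2 * (p + 1 : ℕ) * (2 * (p + 1 : ℕ) + 1 + 2 * m))
        * (2 * (p + 1 : ℕ) + 1 / 3)
      = w ^ 2 / D ^ 2 * ((2 * (p + 1 : ℕ) + 1 / 3) / (2 * (p + 1 : ℕ)))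
        * (N ^ 2 / (2 * (p + 1 : ℕ) + 1 + 2 * m)) := by
        field_simp
    _ ≤ w ^ 2 / D ^ 2 * ((2 * (p + 1 : ℕ) + 1 / 3) / (2 * (p + 1 : ℕ)))
        * ((2 * (p + 1 : ℕ) + 1 / 2) ^ 2 / (2 * (p + 1 : ℕ) + 1) * D ^ 2) := by
        gcongr
    _ = w ^ 2 * ((2 * ((p + 1 : ℕ) : ℝ) + 1 / 2) ^ 2 / (2 * (p + 1 : ℕ) + 1)
      * (2 * (p + 1 : ℕ) + 1 / 3) / (2 * (p + 1 : ℕ))) := by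
        field_simp
    _ ≤ w ^ 2 * (2 * p + 8 / 3) := by gcongr


/-! ### Sup-norm of the iterated primitives -/

/-- The `m`-fold primitive of the Legendre polynomial `L_n` that vanishes at `±1`
(for `m ≤ n`). -/
noncomputable def legendrePrimitive (n m : ℕ) : ℝ[X] :=
  C (1 / (2 ^ n * (n.factorial : ℝ))) * rodrigues n (n - m)

theorem legendrePrimitive_zero (n : ℕ) : legendrePrimitive n 0 = legendre n := rfl

theorem derivative_legendrePrimitive {n m : ℕ} (h : m + 1 ≤ n) :
    derivative (legendrePrimitive n (m + 1)) = legendrePrimitive n m := by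
  rw [legendrePrimitive, derivative_C_mul, derivative_rodrigues,
    show n - (m + 1) + 1 = n - m by omega, legendrePrimitive]

theorem eval_legendrePrimitive_eq_zero {n m : ℕ} (hm : 1 ≤ m) (h : m ≤ n) {x : ℝ}
    (hx : x ^ 2 = 1) : (legendrePrimitive n m).eval x = 0 := by
  rw [legendrePrimitive, eval_mul, eval_rodrigues_eq_zero (by omega) hx, mul_zero]

theorem sq_eval_legendrePrimitive_le {k m : ℕ} (hm : 1 ≤ m) (h : 2 ≤ k + m) {x : ℝ}
    (hx : x ∈ Icc (-1 : ℝ) 1) :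
    ((legendrePrimitive (k + m) m).eval x
      * ∏ j ∈ Finset.Icc 1 m, ((k : ℝ) + 2 * j - 1 / 2)) ^ 2 * (k + 4 / 3) ≤ 2 / 3 := by
  have hS := sq_eval_rodrigues_le (n := k + m) (k := k) (by omega) hx
  rw [legendrePrimitive, eval_mul, eval_C, Nat.add_sub_cancel]
  rcases Nat.even_or_odd' k with ⟨p, rfl | rfl⟩
  · rw [eval_zero_rodrigues_odd, sq_eval_zero_rodrigues_even] at hS
    have hv := even_central_value_le hm h
    push_cast at hS hv ⊢
    refine le_trans ?_ hv
    refine mul_le_mul_of_nonneg_right ?_ (by positivity)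
    rw [mul_pow, mul_pow _ (Finset.prod _ _)]
    refine mul_le_mul_of_nonneg_right ?_ (sq_nonneg _)
    rw [mul_pow, div_pow, div_pow, one_pow, div_mul_eq_mul_div, one_mul]
    refine div_le_div_of_nonneg_right ?_ (sq_nonneg _)
    simpa only [ne_eq, OfNat.ofNat_ne_zero, not_false_eq_true, zero_pow, zero_div, add_zero]
      using hS
  · obtain ⟨m, rfl⟩ := Nat.exists_eq_add_of_le' hm
    rw [eval_zero_rodrigues_odd, show 2 * p + 1 + 1 = 2 * (p + 1) by ring,
      sq_eval_zero_rodrigues_even] at hS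
    have hv := odd_central_slope_le (q := p + 1) (by omega) m
    rw [show 2 * (p + 1) + m = 2 * p + 1 + (m + 1) by ring] at hv
    push_cast at hS hv ⊢
    have hc : 0 ≤ (1 / (2 ^ (2 * p + 1 + (m + 1)) * ((2 * p + 1 + (m + 1)).factorial : ℝ))) ^ 2
        * (∏ j ∈ Finset.Icc 1 (m + 1), (2 * (p : ℝ) + 1 + 2 * j - 1 / 2)) ^ 2
        * (2 * p + 7 / 3) :=
      mul_nonneg (mul_nonneg (sq_nonneg _) (sq_nonneg _)) (by positivity)
    refine le_trans (le_of_eq_of_le ?_ (mul_le_mul_of_nonneg_right hS hc))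
      (le_of_eq_of_le ?_ hv)
    · ring
    · rw [show ∀ s : Finset ℕ, ∏ j ∈ s, (2 * ((p : ℝ) + 1) + 2 * j - 3 / 2)
        = ∏ j ∈ s, (2 * (p : ℝ) + 1 + 2 * j - 1 / 2) from
        fun s ↦ Finset.prod_congr rfl fun _ _ ↦ by ring]
      generalize ∏ j ∈ Finset.Icc 1 (m + 1), (2 * (p : ℝ) + 1 + 2 * j - 1 / 2) = N
      rw [show (2 * (2 * (p : ℝ) + 1 + (m + 1)) - (2 * p + 1)) = 2 * (p + 1) + 1 + 2 * m by ring]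
      have hden : 2 * ((p : ℝ) + 1) + 1 + 2 * m ≠ 0 := by positivity
      have hden' : 2 * (p : ℝ) + 1 + 1 ≠ 0 := by positivity
      field_simp
      ring

/-! ### Functions of bounded variation have finite mass -/

theorem contDiff_eval (P : ℝ[X]) (k : WithTop ℕ∞) : ContDiff ℝ k fun x ↦ P.eval x := by
  simpa using P.contDiff_aeval (𝕜 := ℝ) k

/-- Extend `p` by constants to a monotone `G` on the line. The integral is the derivative at `0` of
`x ↦ ∫ φ(t) G(t - x) dt`, so a Lipschitz estimate at `0` suffices; this avoids Stieltjes measures.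
-/
theorem abs_integral_mul_deriv_le_of_monotoneOn {p : ℝ → ℝ} (hp : MonotoneOn p (Icc (-1) 1))
    {φ : ℝ → ℝ} (hφ : ContDiff ℝ 1 φ) (hc : HasCompactSupport φ) (hs : tsupport φ ⊆ Ioo (-1) 1)
    (h1 : ∀ x, |φ x| ≤ 1) :
    |∫ x in (-1 : ℝ)..1, p x * deriv φ x| ≤ p 1 - p (-1) := by
  set G : ℝ → ℝ := fun x ↦ p (max (-1) (min x 1)) with hG
  have hmem : ∀ x : ℝ, max (-1) (min x 1) ∈ Icc (-1 : ℝ) 1 := fun x ↦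
    ⟨le_max_left _ _, max_le (by norm_num) (min_le_right _ _)⟩
  have hGm : Monotone G := fun x y hxy ↦ hp (hmem x) (hmem y) (by gcongr)
  have hGp : ∀ x ∈ Icc (-1 : ℝ) 1, G x = p x := fun x hx ↦ by
    simp only [hG, min_eq_left hx.2, max_eq_right hx.1]
  have hl : ∀ x, p (-1) ≤ G x := fun x ↦ hp (by norm_num) (hmem x) (hmem x).1
  have hu : ∀ x, G x ≤ p 1 := fun x ↦ hp (hmem x) (by norm_num) (hmem x).2
  have hD : 0 ≤ p 1 - p (-1) := sub_nonneg.2 ((hl 0).trans (hu 0))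
  have hGi : LocallyIntegrable (fun x ↦ G (-x)) volume := by
    have : Antitone fun x ↦ G (-x) := fun x y hxy ↦ hGm (neg_le_neg hxy)
    exact this.locallyIntegrable
  have hd := hc.hasDerivAt_convolution_left (ContinuousLinearMap.mul ℝ ℝ) (μ := volume) hφ hGi 0
  have hsub : ∀ ψ : ℝ → ℝ, Function.support ψ ⊆ tsupport φ → ∀ x,
      convolution ψ (fun x ↦ G (-x)) (ContinuousLinearMap.mul ℝ ℝ) volume x
        = ∫ t in (-1 : ℝ)..1, ψ t * G (t - x) := by
    intro ψ hψ x
    rw [intervalIntegral.integral_eq_integral_of_support_subset]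
    · simp [convolution]
    · exact (Function.support_mul_subset_left _ _).trans
        (hψ.trans (hs.trans Ioo_subset_Ioc_self))
  have hval : ∫ x in (-1 : ℝ)..1, p x * deriv φ x
      = convolution (deriv φ) (fun x ↦ G (-x)) (ContinuousLinearMap.mul ℝ ℝ) volume 0 := by
    rw [hsub _ (support_deriv_subset)]
    refine intervalIntegral.integral_congr fun x hx ↦ ?_
    rw [uIcc_of_le (by norm_num)] at hx
    simp only [sub_zero, hGp x hx, mul_comm]
  rw [hval]
  refine hd.le_of_lip' hD (Eventually.of_forall fun x ↦ ?_)
  have hGint : ∀ a b c : ℝ, IntervalIntegrable (fun t ↦ G (t - c)) volume a b := fun a b c ↦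
    (show Monotone fun t ↦ G (t - c) from fun s t hst ↦ hGm (by linarith)).intervalIntegrable
  have hGint0 : ∀ a b : ℝ, IntervalIntegrable G volume a b := fun a b ↦ hGm.intervalIntegrable
  rw [hsub _ (subset_tsupport φ), hsub _ (subset_tsupport φ),
    ← intervalIntegral.integral_sub ((hGint _ _ _).continuousOn_mul hφ.continuous.continuousOn)
      ((hGint _ _ _).continuousOn_mul hφ.continuous.continuousOn)]
  simp only [sub_zero, ← mul_sub]
  -- The overlap of the shifted intervals cancels, leaving an integral over an interval of length
  -- `|x|`.
  have hshift : |∫ t in (-1 : ℝ)..1, (G (t - x) - G t)| ≤ (p 1 - p (-1)) * |x| := by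
    have e : ∫ t in (-1 : ℝ)..1, (G (t - x) - G t) = ∫ t in (1 - x)..1, (G (t - 2) - G t) := by
      rw [intervalIntegral.integral_sub (hGint _ _ _) (hGint0 _ _),
        intervalIntegral.integral_sub (hGint _ _ _) (hGint0 _ _),
        intervalIntegral.integral_comp_sub_right, intervalIntegral.integral_comp_sub_right,
        intervalIntegral.integral_interval_sub_interval_comm (hGint0 _ _) (hGint0 _ _)
          (hGint0 _ _)]
      norm_num
      ring_nf
    rw [e]
    have := intervalIntegral.norm_integral_le_of_norm_le_const (a := 1 - x) (b := 1)
      (f := fun t ↦ G (t - 2) - G t) (C := p 1 - p (-1)) fun t _ ↦ by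
        rw [Real.norm_eq_abs, abs_le]
        constructor <;> linarith [hl t, hu t, hl (t - 2), hu (t - 2)]
    simpa using this
  -- Monotonicity gives `G (t - x) - G t` a constant sign in `t`.
  have habs : ∫ t in (-1 : ℝ)..1, |G (t - x) - G t| = |∫ t in (-1 : ℝ)..1, (G (t - x) - G t)| := by
    have hnn : 0 ≤ ∫ t in (-1 : ℝ)..1, |G (t - x) - G t| :=
      intervalIntegral.integral_nonneg (by norm_num) fun _ _ ↦ abs_nonneg _
    rcases le_total 0 x with h | h
    · have e : ∀ t, |G (t - x) - G t| = -(G (t - x) - G t) := fun t ↦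
        abs_of_nonpos (sub_nonpos.2 (hGm (by linarith)))
      simp only [e, intervalIntegral.integral_neg] at hnn ⊢
      exact (abs_of_nonpos (by linarith)).symm
    · have e : ∀ t, |G (t - x) - G t| = G (t - x) - G t := fun t ↦
        abs_of_nonneg (sub_nonneg.2 (hGm (by linarith)))
      simp only [e] at hnn ⊢
      exact (abs_of_nonneg hnn).symm
  refine le_trans ?_ (habs.le.trans hshift)
  refine intervalIntegral.norm_integral_le_of_norm_le (by norm_num)
    (Eventually.of_forall fun t _ ↦ ?_) ((hGint _ _ _).sub (hGint0 _ _)).abs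
  rw [norm_mul]
  exact mul_le_of_le_one_left (norm_nonneg _) (h1 t)

theorem IsBV.exists_monotoneOn {g : ℝ → ℝ} (hg : IsBV g) :
    ∃ p q : ℝ → ℝ, MonotoneOn p (Icc (-1) 1) ∧ MonotoneOn q (Icc (-1) 1) ∧
      ∀ᵐ x, x ∈ Icc (-1 : ℝ) 1 → g x = p x - q x := by
  obtain ⟨h, hh, hgh⟩ := hg
  obtain ⟨p, q, hp, hq, rfl⟩ := hh.locallyBoundedVariationOn.exists_monotoneOn_sub_monotoneOn
  exact ⟨p, q, hp, hq, (ae_restrict_iff' measurableSet_Icc).1 hgh⟩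

theorem intervalIntegrable_of_monotoneOn {p : ℝ → ℝ} (hp : MonotoneOn p (Icc (-1) 1)) :
    IntervalIntegrable p volume (-1) 1 := by
  rw [← uIcc_of_le (by norm_num)] at hp
  exact hp.intervalIntegrable

theorem IsBV.intervalIntegrable {g : ℝ → ℝ} (hg : IsBV g) :
    IntervalIntegrable g volume (-1) 1 := by
  obtain ⟨p, q, hp, hq, h⟩ := hg.exists_monotoneOn
  refine ((intervalIntegrable_of_monotoneOn hp).sub
    (intervalIntegrable_of_monotoneOn hq)).congr_ae ?_
  rw [Filter.EventuallyEq, ae_restrict_iff' measurableSet_uIoc]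
  filter_upwards [h] with x hx hxm
  rw [uIoc_of_le (by norm_num)] at hxm
  exact (hx (Ioc_subset_Icc_self hxm)).symm

/-- Needed because `U` is a `toReal`, which would turn an infinite mass into `0`. -/
theorem IsBV.massOfDeriv_ne_top {g : ℝ → ℝ} (hg : IsBV g) : massOfDeriv g ≠ ⊤ := by
  obtain ⟨p, q, hp, hq, h⟩ := hg.exists_monotoneOn
  refine ne_top_of_le_ne_top
    (ENNReal.ofReal_ne_top (r := (p 1 - p (-1)) + (q 1 - q (-1)))) ?_
  refine iSup_le fun φ ↦ iSup_le fun hφ ↦ iSup_le fun hc ↦ iSup_le fun hs ↦ iSup_le fun h1 ↦ ?_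
  refine ENNReal.ofReal_le_ofReal ?_
  have hcont : ContinuousOn (deriv φ) (uIcc (-1) 1) :=
    (hφ.continuous_deriv le_rfl).continuousOn
  have e : ∫ x in (-1 : ℝ)..1, g x * deriv φ x
      = (∫ x in (-1 : ℝ)..1, p x * deriv φ x) - ∫ x in (-1 : ℝ)..1, q x * deriv φ x := by
    rw [← intervalIntegral.integral_sub
      ((intervalIntegrable_of_monotoneOn hp).mul_continuousOn hcont)
      ((intervalIntegrable_of_monotoneOn hq).mul_continuousOn hcont)]
    refine intervalIntegral.integral_congr_ae ?_
    filter_upwards [h] with x hx hxm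
    rw [uIoc_of_le (by norm_num)] at hxm
    rw [hx (Ioc_subset_Icc_self hxm), sub_mul]
  have h2 := (abs_le.1 (abs_integral_mul_deriv_le_of_monotoneOn hp hφ hc hs h1)).1
  have h3 := (abs_le.1 (abs_integral_mul_deriv_le_of_monotoneOn hq hφ hc hs h1)).2
  linarith

theorem neg_integral_mul_deriv_le {g : ℝ → ℝ} (hg : massOfDeriv g ≠ ⊤) {φ : ℝ → ℝ}
    (hφ : ContDiff ℝ 1 φ) (hs : tsupport φ ⊆ Ioo (-1) 1) {M : ℝ} (hM : 0 < M)
    (h : ∀ x, |φ x| ≤ M) :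
    -∫ x in (-1 : ℝ)..1, g x * deriv φ x ≤ M * (massOfDeriv g).toReal := by
  have hts : tsupport (fun x ↦ M⁻¹ * φ x) ⊆ tsupport φ :=
    closure_mono (Function.support_mul_subset_right _ _)
  have hc : HasCompactSupport fun x ↦ M⁻¹ * φ x :=
    isCompact_Icc.of_isClosed_subset (isClosed_tsupport _)
      (hts.trans (hs.trans Ioo_subset_Icc_self))
  have key : -∫ x in (-1 : ℝ)..1, g x * deriv (fun x ↦ M⁻¹ * φ x) x
      ≤ (massOfDeriv g).toReal := by
    rw [← ENNReal.ofReal_le_iff_le_toReal hg]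
    refine le_iSup_of_le (fun x ↦ M⁻¹ * φ x) (le_iSup_of_le (contDiff_const.mul hφ)
      (le_iSup_of_le hc (le_iSup_of_le (hts.trans hs) (le_iSup_of_le (fun x ↦ ?_) le_rfl))))
    rw [abs_mul, abs_of_pos (inv_pos.2 hM), inv_mul_le_iff₀ hM, mul_one]
    exact h x
  simp only [deriv_const_mul_field, mul_left_comm (g _) M⁻¹,
    intervalIntegral.integral_const_mul] at key
  rwa [← mul_neg, inv_mul_le_iff₀ hM] at key

/-! ### From compactly supported test functions to polynomials vanishing at `±1` -/

/-- A continuous approximation of the indicator function of `{0}ᶜ`. -/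
noncomputable def ramp (ε t : ℝ) : ℝ := max 0 (min 1 (|t| / ε - 1))

theorem continuous_ramp (ε : ℝ) : Continuous (ramp ε) := by unfold ramp; fun_prop

theorem abs_ramp_le (ε t : ℝ) : |ramp ε t| ≤ 1 := by
  rw [abs_of_nonneg (le_max_left _ _)]
  exact max_le zero_le_one (min_le_left _ _)

theorem ramp_eq_zero {ε t : ℝ} (hε : 0 < ε) (h : |t| ≤ ε) : ramp ε t = 0 := by
  refine max_eq_left ((min_le_right _ _).trans ?_)
  rw [sub_nonpos, div_le_one hε]
  exact h

theorem ramp_eq_one {ε t : ℝ} (hε : 0 < ε) (h : 2 * ε ≤ |t|) : ramp ε t = 1 := by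
  rw [ramp, min_eq_left, max_eq_right zero_le_one]
  rw [le_sub_iff_add_le, le_div_iff₀ hε]
  linarith

/-- A `C^1` contraction vanishing near `0`, close to the identity for small `ε`. -/
noncomputable def softThreshold (ε y : ℝ) : ℝ := ∫ t in (0 : ℝ)..y, ramp ε t

theorem hasDerivAt_softThreshold (ε y : ℝ) : HasDerivAt (softThreshold ε) (ramp ε y) y :=
  intervalIntegral.integral_hasDerivAt_right ((continuous_ramp ε).intervalIntegrable _ _)
    ((continuous_ramp ε).stronglyMeasurableAtFilter _ _) (continuous_ramp ε).continuousAt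

theorem contDiff_softThreshold (ε : ℝ) : ContDiff ℝ 1 (softThreshold ε) := by
  rw [contDiff_one_iff_deriv]
  refine ⟨fun y ↦ (hasDerivAt_softThreshold ε y).differentiableAt, ?_⟩
  rw [show deriv (softThreshold ε) = ramp ε from
    funext fun y ↦ (hasDerivAt_softThreshold ε y).deriv]
  exact continuous_ramp ε

theorem abs_softThreshold_le (ε y : ℝ) : |softThreshold ε y| ≤ |y| := by
  have := intervalIntegral.norm_integral_le_of_norm_le_const (a := 0) (b := y) (f := ramp ε)
    (C := 1) fun t _ ↦ abs_ramp_le ε t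
  simpa [softThreshold] using this

theorem softThreshold_eq_zero {ε y : ℝ} (hε : 0 < ε) (h : |y| ≤ ε) : softThreshold ε y = 0 := by
  rw [softThreshold, intervalIntegral.integral_zero_ae]
  refine Eventually.of_forall fun t ht ↦ ramp_eq_zero hε (le_trans ?_ h)
  have := abs_sub_left_of_mem_uIcc (uIoc_subset_uIcc ht)
  simpa using this

/-- A compactly supported `C^1` approximation on `(-1, 1)` of a function vanishing at `±1`. -/
noncomputable def truncation (ε : ℝ) (φ : ℝ → ℝ) (x : ℝ) : ℝ :=
  open Classical in if x ∈ Icc (-1 : ℝ) 1 then softThreshold ε (φ x) else 0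

theorem truncation_eventuallyEq_zero {ε : ℝ} (hε : 0 < ε) {φ : ℝ → ℝ} (hφ : Continuous φ)
    (hz : ∀ x : ℝ, x ^ 2 = 1 → φ x = 0) {x : ℝ} (hx : x ∉ Ioo (-1 : ℝ) 1) :
    truncation ε φ =ᶠ[𝓝 x] 0 := by
  by_cases hx' : x ∈ Icc (-1 : ℝ) 1
  · have hx0 : φ x = 0 := by
      refine hz x ?_
      rcases hx'.1.eq_or_lt with h | h
      · rw [← h]; norm_num
      · rcases hx'.2.eq_or_lt with h' | h'
        · rw [h']; norm_num
        · exact absurd ⟨h, h'⟩ hx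
    have : ∀ᶠ y in 𝓝 x, |φ y| < ε :=
      hφ.abs.continuousAt.eventually_lt continuousAt_const (by simpa [hx0] using hε)
    filter_upwards [this] with y hy
    simp [truncation, softThreshold_eq_zero hε hy.le]
  · filter_upwards [isClosed_Icc.isOpen_compl.mem_nhds hx'] with y hy
    exact if_neg hy

theorem truncation_eventuallyEq (ε : ℝ) (φ : ℝ → ℝ) {x : ℝ} (hx : x ∈ Ioo (-1 : ℝ) 1) :
    truncation ε φ =ᶠ[𝓝 x] softThreshold ε ∘ φ := by
  filter_upwards [Icc_mem_nhds hx.1 hx.2] with y hy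
  exact if_pos hy

theorem contDiff_truncation {ε : ℝ} (hε : 0 < ε) {φ : ℝ → ℝ} (hφ : ContDiff ℝ 1 φ)
    (hz : ∀ x : ℝ, x ^ 2 = 1 → φ x = 0) : ContDiff ℝ 1 (truncation ε φ) := by
  rw [contDiff_iff_contDiffAt]
  intro x
  by_cases hx : x ∈ Ioo (-1 : ℝ) 1
  · exact ((contDiff_softThreshold ε).comp hφ).contDiffAt.congr_of_eventuallyEq
      (truncation_eventuallyEq ε φ hx)
  · exact contDiffAt_const.congr_of_eventuallyEq
      (truncation_eventuallyEq_zero hε hφ.continuous hz hx)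

theorem deriv_truncation {ε : ℝ} (hε : 0 < ε) {φ : ℝ → ℝ} (hφ : ContDiff ℝ 1 φ)
    (hz : ∀ x : ℝ, x ^ 2 = 1 → φ x = 0) {x : ℝ} (hx : x ∈ Icc (-1 : ℝ) 1) :
    deriv (truncation ε φ) x = ramp ε (φ x) * deriv φ x := by
  by_cases hx' : x ∈ Ioo (-1 : ℝ) 1
  · rw [(truncation_eventuallyEq ε φ hx').deriv_eq]
    exact ((hasDerivAt_softThreshold ε (φ x)).comp x
      (hφ.differentiable one_ne_zero x).hasDerivAt).deriv
  · have h0 := truncation_eventuallyEq_zero hε hφ.continuous hz hx'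
    have hx0 : φ x = 0 := by
      refine hz x ?_
      rcases hx.1.eq_or_lt with h | h
      · rw [← h]; norm_num
      · rcases hx.2.eq_or_lt with h' | h'
        · rw [h']; norm_num
        · exact absurd ⟨h, h'⟩ hx'
    rw [h0.deriv_eq, hx0, ramp_eq_zero hε (by simpa using hε.le), zero_mul]
    simp

/-- `P` is not an admissible test function. Thresholding its values, rather than cutting off in `x`,
gives compact support in `(-1, 1)`, keeps the bound `M`, and only multiplies `P'` by a factor in
`[0, 1]`. -/
theorem neg_integral_mul_derivative_le {g : ℝ → ℝ} (hg : IsBV g) {P : ℝ[X]} (hP : P ≠ 0)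
    (hz : ∀ x : ℝ, x ^ 2 = 1 → P.eval x = 0) {M : ℝ} (hM : 0 < M)
    (h : ∀ x ∈ Icc (-1 : ℝ) 1, |P.eval x| ≤ M) :
    -∫ x in (-1 : ℝ)..1, g x * (derivative P).eval x ≤ M * (massOfDeriv g).toReal := by
  have hPc : ContDiff ℝ 1 fun x ↦ P.eval x := contDiff_eval P 1
  have hlim : Tendsto (fun ε ↦ ∫ x in (-1 : ℝ)..1,
      g x * (ramp ε (P.eval x) * (derivative P).eval x)) (𝓝[>] 0)
      (𝓝 (∫ x in (-1 : ℝ)..1, g x * (derivative P).eval x)) := by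
    have hgi := hg.intervalIntegrable
    refine intervalIntegral.tendsto_integral_filter_of_dominated_convergence
      (fun x ↦ |g x * (derivative P).eval x|) (Eventually.of_forall fun ε ↦ ?_)
      (Eventually.of_forall fun ε ↦ Eventually.of_forall fun x _ ↦ ?_)
      (hgi.mul_continuousOn (derivative P).continuous.continuousOn).abs ?_
    · exact hgi.def'.aestronglyMeasurable.mul
        (((continuous_ramp ε).comp P.continuous).mul (derivative P).continuous).aestronglyMeasurable
    · rw [Real.norm_eq_abs, mul_left_comm, abs_mul]
      exact mul_le_of_le_one_left (abs_nonneg _) (abs_ramp_le _ _)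
    -- Off the finitely many zeros of `P` the ramp factor is eventually `1` as `ε → 0`.
    · have hroots : {x : ℝ | P.eval x = 0}.Finite := by
        refine P.roots.toFinset.finite_toSet.subset fun x hx ↦ ?_
        simpa [hP] using hx
      filter_upwards [hroots.countable.ae_notMem volume] with x hx _
      have hx : P.eval x ≠ 0 := hx
      refine tendsto_const_nhds.congr' ?_
      have hpos : 0 < |P.eval x| / 2 := by positivity
      filter_upwards [Ioc_mem_nhdsGT hpos] with ε hε
      rw [ramp_eq_one hε.1 (by linarith [hε.2]), one_mul]
  refine le_of_tendsto hlim.neg ?_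
  filter_upwards [self_mem_nhdsWithin] with ε hε
  have hε : 0 < ε := hε
  have hs : tsupport (truncation ε fun x ↦ P.eval x) ⊆ Ioo (-1) 1 := by
    intro x hx
    by_contra hx'
    exact notMem_tsupport_iff_eventuallyEq.2
      (truncation_eventuallyEq_zero hε P.continuous hz hx') hx
  have key := neg_integral_mul_deriv_le hg.massOfDeriv_ne_top (contDiff_truncation hε hPc hz) hs
    hM fun x ↦ by
      unfold truncation
      split_ifs with hx
      · exact (abs_softThreshold_le _ _).trans (h x hx)
      · simpa using hM.le
  refine le_of_eq_of_le (congrArg _ (intervalIntegral.integral_congr fun x hx ↦ ?_)) key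
  rw [uIcc_of_le (by norm_num)] at hx
  simp only [deriv_truncation hε hPc hz hx, Polynomial.deriv]

theorem abs_integral_mul_derivative_le {g : ℝ → ℝ} (hg : IsBV g) {P : ℝ[X]} (hP : P ≠ 0)
    (hz : ∀ x : ℝ, x ^ 2 = 1 → P.eval x = 0) {M : ℝ} (hM : 0 < M)
    (h : ∀ x ∈ Icc (-1 : ℝ) 1, |P.eval x| ≤ M) :
    |∫ x in (-1 : ℝ)..1, g x * (derivative P).eval x| ≤ M * (massOfDeriv g).toReal := by
  have h1 := neg_integral_mul_derivative_le hg hP hz hM h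
  have h2 := neg_integral_mul_derivative_le hg (neg_ne_zero.2 hP)
    (fun x hx ↦ by rw [eval_neg, hz x hx, neg_zero]) hM
    (fun x hx ↦ by rw [eval_neg, abs_neg]; exact h x hx)
  simp only [derivative_neg, eval_neg, mul_neg, intervalIntegral.integral_neg, neg_neg] at h2
  exact abs_le.2 ⟨by linarith, h2⟩

/-! ### Integration by parts and conclusion -/

theorem integral_derivOn_mul_derivative {f : ℝ → ℝ} {k : ℕ}
    (hAC : AbsolutelyContinuousOnInterval (derivOn f k) (-1) 1) {P : ℝ[X]}
    (hz : ∀ x : ℝ, x ^ 2 = 1 → P.eval x = 0) :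
    ∫ x in (-1 : ℝ)..1, derivOn f k x * (derivative P).eval x
      = -∫ x in (-1 : ℝ)..1, derivOn f (k + 1) x * P.eval x := by
  have hP : AbsolutelyContinuousOnInterval (fun x ↦ P.eval x) (-1) 1 :=
    (contDiff_eval P 1).contDiffOn.absolutelyContinuousOnInterval
  have h := hAC.integral_mul_deriv_eq_deriv_mul hP
  rw [hz 1 (by norm_num), hz (-1) (by norm_num)] at h
  simp only [Polynomial.deriv, mul_zero, sub_zero, zero_sub] at h
  rw [h]
  congr 1
  refine intervalIntegral.integral_congr_ae ?_
  -- The within-derivative is identified with `deriv` at interior points; in `Ioc (-1) 1` only `1`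
  -- must be discarded.
  filter_upwards [(countable_singleton (1 : ℝ)).ae_notMem volume] with x hx hxm
  rw [uIoc_of_le (by norm_num)] at hxm
  have hx1 : x < 1 := lt_of_le_of_ne hxm.2 hx
  have : derivOn f (k + 1) x = deriv (derivOn f k) x := by
    rw [derivOn, iteratedDerivWithin_succ, derivWithin_of_mem_nhds (Icc_mem_nhds hxm.1 hx1)]
    rfl
  rw [this]

theorem abs_integral_mul_legendre_eq {f : ℝ → ℝ} {r n : ℕ}
    (hAC : ∀ k < r, AbsolutelyContinuousOnInterval (derivOn f k) (-1) 1) (hr : r ≤ n) :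
    |∫ x in (-1 : ℝ)..1, f x * (legendre n).eval x|
      = |∫ x in (-1 : ℝ)..1, derivOn f r x * (legendrePrimitive n r).eval x| := by
  induction r with
  | zero => rw [legendrePrimitive_zero, derivOn, iteratedDerivWithin_zero]
  | succ r ih =>
    rw [ih (fun k hk ↦ hAC k (by omega)) (by omega), ← derivative_legendrePrimitive hr,
      integral_derivOn_mul_derivative (hAC r (by omega))
        (fun x hx ↦ eval_legendrePrimitive_eq_zero (by omega) hr hx), abs_neg]

theorem legendrePrimitive_ne_zero (n m : ℕ) : legendrePrimitive n m ≠ 0 := by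
  have hmonic : ((X ^ 2 - 1 : ℝ[X]) ^ n).Monic := (monic_X_pow_sub_C 1 two_ne_zero).pow n
  have hdeg : ((X ^ 2 - 1 : ℝ[X]) ^ n).natDegree = n * 2 := by
    rw [natDegree_pow, ← C_1, natDegree_X_pow_sub_C]
  refine mul_ne_zero (C_ne_zero.2 (by positivity)) fun h ↦ ?_
  have h1 := congrArg (fun q : ℝ[X] ↦ q.coeff (n * 2 - (n - m))) h
  simp only [rodrigues, coeff_iterate_derivative, coeff_zero] at h1
  rw [show n * 2 - (n - m) + (n - m) = n * 2 by omega, ← hdeg, hmonic.coeff_natDegree,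
    nsmul_eq_mul, mul_one, Nat.cast_eq_zero, Nat.descFactorial_eq_zero_iff_lt, hdeg] at h1
  omega

/-- The bound for the primitives of `L_n`, with a constant smaller than `0.825031`. -/
theorem abs_eval_legendrePrimitive_le {n r : ℕ} (hn : r + 1 ≤ n) (hn2 : 2 ≤ n) {x : ℝ}
    (hx : x ∈ Icc (-1 : ℝ) 1) :
    |(legendrePrimitive n (r + 1)).eval x| ≤ 0.825 / (Real.sqrt ((n : ℝ) - r + 1 / 3) *
      ∏ j ∈ Finset.Icc 1 (r + 1), ((n : ℝ) - r + 2 * (j : ℝ) - 3 / 2)) := by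
  obtain ⟨k, rfl⟩ := Nat.exists_eq_add_of_le' hn
  have h := sq_eval_legendrePrimitive_le (k := k) (m := r + 1) (by omega) hn2 hx
  have e1 : ((k + (r + 1) : ℕ) : ℝ) - r = k + 1 := by push_cast; ring
  rw [e1, show (k : ℝ) + 1 + 1 / 3 = k + 4 / 3 by ring,
    show ∏ j ∈ Finset.Icc 1 (r + 1), ((k : ℝ) + 1 + 2 * j - 3 / 2)
      = ∏ j ∈ Finset.Icc 1 (r + 1), ((k : ℝ) + 2 * j - 1 / 2) from
      Finset.prod_congr rfl fun _ _ ↦ by ring]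
  have hpos : 0 < ∏ j ∈ Finset.Icc 1 (r + 1), ((k : ℝ) + 2 * j - 1 / 2) :=
    Finset.prod_pos fun j hj ↦ by
      have : (1 : ℝ) ≤ j := by exact_mod_cast (Finset.mem_Icc.1 hj).1
      have : (0 : ℝ) ≤ k := k.cast_nonneg
      linarith
  have hk : (0 : ℝ) < k + 4 / 3 := by positivity
  rw [le_div_iff₀ (mul_pos (Real.sqrt_pos.2 hk) hpos)]
  refine abs_le_of_sq_le_sq' ?_ (by norm_num) |>.2
  rw [mul_pow, sq_abs, mul_pow, Real.sq_sqrt hk.le]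
  rw [mul_pow] at h
  -- `2/3 ≤ 0.825 ^ 2 = 0.680625`.
  nlinarith

end LegendreBound

theorem theorem2p1 (f : ℝ → ℝ) (r n : ℕ)
    (hAC : ∀ k < r, AbsolutelyContinuousOnInterval (LegendreBound.derivOn f k) (-1) 1)
    (hBV : LegendreBound.IsBV (LegendreBound.derivOn f r))
    (hn : r + 1 ≤ n) (hn2 : 2 ≤ n) :
    |LegendreBound.legendreCoeff f n| ≤ LegendreBound.coeffBound f r n ∧
      (LegendreBound.U f r ≠ 0 →
        |LegendreBound.legendreCoeff f n| < LegendreBound.coeffBound f r n) := by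
  have hrn : (r : ℝ) + 1 ≤ n := by exact_mod_cast hn
  have hD : 0 < Real.sqrt ((n : ℝ) - r + 1 / 3) *
      ∏ j ∈ Finset.Icc 1 (r + 1), ((n : ℝ) - r + 2 * (j : ℝ) - 3 / 2) := by
    refine mul_pos (Real.sqrt_pos.2 (by linarith)) (Finset.prod_pos fun j hj ↦ ?_)
    have : (1 : ℝ) ≤ j := by exact_mod_cast (Finset.mem_Icc.1 hj).1
    linarith
  have hU : 0 ≤ LegendreBound.U f r := ENNReal.toReal_nonneg
  have hc : 0 < (n : ℝ) + 1 / 2 := by positivity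
  have hI := LegendreBound.abs_integral_mul_derivative_le hBV
    (LegendreBound.legendrePrimitive_ne_zero n (r + 1))
    (fun x hx ↦ LegendreBound.eval_legendrePrimitive_eq_zero (by omega) hn hx)
    (div_pos (by norm_num) hD)
    (fun x hx ↦ LegendreBound.abs_eval_legendrePrimitive_le hn hn2 hx)
  rw [LegendreBound.derivative_legendrePrimitive hn,
    ← LegendreBound.abs_integral_mul_legendre_eq hAC (by omega)] at hI
  have hle : |LegendreBound.legendreCoeff f n| ≤
      0.825 * (((n : ℝ) + 1 / 2) * LegendreBound.U f r /
        (Real.sqrt ((n : ℝ) - r + 1 / 3) *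
          ∏ j ∈ Finset.Icc 1 (r + 1), ((n : ℝ) - r + 2 * (j : ℝ) - 3 / 2))) := by
    rw [LegendreBound.legendreCoeff, abs_mul, abs_of_pos hc]
    refine (mul_le_mul_of_nonneg_left hI hc.le).trans_eq ?_
    rw [LegendreBound.U]
    ring
  have hbound : LegendreBound.coeffBound f r n =
      0.825031 * (((n : ℝ) + 1 / 2) * LegendreBound.U f r /
        (Real.sqrt ((n : ℝ) - r + 1 / 3) *
          ∏ j ∈ Finset.Icc 1 (r + 1), ((n : ℝ) - r + 2 * (j : ℝ) - 3 / 2))) := by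
    rw [LegendreBound.coeffBound]
    ring
  rw [hbound]
  refine ⟨hle.trans ?_, fun hU0 ↦ hle.trans_lt ?_⟩
  · have := div_nonneg (mul_nonneg hc.le hU) hD.le
    nlinarith
  · have := div_pos (mul_pos hc (hU.lt_of_ne' hU0)) hD
    nlinarith
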